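/- Let $v$ be a place of $\mathbb{Q}$. Put $R_v=\mathbb{Z}_p$ if $\mathbb{Q}_v=\mathbb{Q}_p$ for a prime $p$, and $R_v=\mathbb{R}$ if $\mathbb{Q}_v=\mathbb{R}$. Let $(K,\alpha)$ be a monogenized cubic étale algebra over $\mathbb{Q}_v$: that is, $K$ is an étale $\mathbb{Q}_v$-algebra of degree $3$ and $\alpha\in K$ is such that the integral closure of $R_v$ in $K$ equals $R_v[\alpha]$. Let $f(x,y)=x^3+ax^2y+bxy^2+cy^3\in\mathbb{Q}_v[x,y]$ be the corresponding monic binary cubic form, i.e. $f(x,1)$ is the minimal polynomial of $\alpha$ over $\mathbb{Q}_v$. With $I(f)=a^2-3b$ and $J(f)=-2a^3+9ab-27c$, let $$E=E_f\colon\quad y^2=x^3-\frac{3^4I(f)}{3}\,x-\frac{3^6J(f)}{27}$$ be the associated elliptic curve over $\mathbb{Q}_v$. Let $G_{\mathbb{Q}_v}$ be the absolute Galois group of $\mathbb{Q}_v$ and $I_v\subset G_{\mathbb{Q}_v}$ the inertia subgroup, where $I_v=G_{\mathbb{R}}$ if $v$ is infinite (that is, $\mathbb{C}/\mathbb{R}$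 counts as ramified). Define the group of unramified classes $$H^1_{\rm ur}(\mathbb{Q}_v,E[2])=\ker\big(H^1(G_{\mathbb{Q}_v},E[2](\overline{\mathbb{Q}_v}))\to H^1(I_v,E[2](\overline{\mathbb{Q}_v}))\big),$$ where $H^1$ is continuous group cohomology with coefficients in a discrete module. Then $$\#H^1_{\rm ur}(\mathbb{Q}_v,E[2])=\begin{cases}\#E(\mathbb{Q}_v)[2]&\text{if $v$ is a finite place},\\ 1&\text{if $v$ is the infinite place}.\end{cases}$$ -/

import Mathlib

open scoped NNReal Polynomial

/-! ### First cohomology of a profinite group with discrete coefficients -/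

section Cohomology

variable (G M : Type*) [Group G] [TopologicalSpace G] [AddCommGroup M] [DistribMulAction G M]

/-- Continuous 1-cocycles `Z¹(G, M)` of the topological group `G` with values in the discrete
`G`-module `M`: a map to a discrete space is continuous iff it is locally constant. -/
def contCocycles : AddSubgroup (G → M) where
  carrier := {c | IsLocallyConstant c ∧ groupCohomology.IsCocycle₁ c}
  zero_mem' := ⟨IsLocallyConstant.const 0, fun g h => by simp⟩
  add_mem' := by
    rintro a b ⟨ha, ha'⟩ ⟨hb, hb'⟩
    refine ⟨ha.add hb, fun g h => ?_⟩
    simp only [Pi.add_apply, ha' g h, hb' g h, smul_add]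
    abel
  neg_mem' := by
    rintro a ⟨ha, ha'⟩
    refine ⟨ha.neg, fun g h => ?_⟩
    simp only [Pi.neg_apply, ha' g h, smul_neg]
    abel

/-- The 1-coboundaries `g ↦ g • m - m`, inside the continuous 1-cocycles. -/
def contCoboundaries : AddSubgroup (contCocycles G M) where
  carrier := {c | groupCohomology.IsCoboundary₁ (c : G → M)}
  zero_mem' := ⟨0, fun g => by simp⟩
  add_mem' := by
    rintro a b ⟨x, hx⟩ ⟨y, hy⟩
    refine ⟨x + y, fun g => ?_⟩
    simp only [AddSubgroup.coe_add, Pi.add_apply, ← hx g, ← hy g, smul_add]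
    abel
  neg_mem' := by
    rintro a ⟨x, hx⟩
    refine ⟨-x, fun g => ?_⟩
    simp only [AddSubgroup.coe_neg, Pi.neg_apply, ← hx g, smul_neg]
    abel

/-- `H¹(G, M)`: continuous 1-cocycles modulo 1-coboundaries. -/
abbrev ContH1 : Type _ := contCocycles G M ⧸ contCoboundaries G M

/-- Restriction of continuous 1-cocycles to a subgroup. -/
def contCocycles.res (H : Subgroup G) : contCocycles G M →+ contCocycles H M where
  toFun c := ⟨fun h => (c : G → M) h,
    c.2.1.comp_continuous continuous_subtype_val, fun g h => c.2.2 g h⟩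
  map_zero' := rfl
  map_add' _ _ := rfl

/-- The restriction map `H¹(G, M) → H¹(H, M)`. -/
def ContH1.res (H : Subgroup G) : ContH1 G M →+ ContH1 H M :=
  QuotientAddGroup.map _ _ (contCocycles.res G M H) (by
    rintro c ⟨x, hx⟩
    exact ⟨x, fun h => hx h⟩)

end Cohomology

/-! ### Torsion points of a Weierstrass curve as a Galois module -/

section Torsion

variable {F : Type*} [Field F] (W : WeierstrassCurve F) (L : Type*) [Field L] [Algebra F L]

open scoped Classical in
/-- `E(L)[n]`, for a Weierstrass curve `E` over `F` and a field extension `L` of `F`. -/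
noncomputable def torsionPoints (n : ℕ) : AddSubgroup (W.baseChange L).toAffine.Point :=
  AddSubgroup.torsionBy _ (n : ℤ)

open scoped Classical in
/-- `Gal(L/F)` acts on `E(L)[n]` through the coordinates of points. -/
noncomputable instance torsionPoints.galoisAction (n : ℕ) :
    DistribMulAction Gal(L/F) (torsionPoints W L n) where
  smul σ P := ⟨WeierstrassCurve.Affine.Point.map (W' := W) σ.toAlgHom P.1, by
    have h : (n : ℤ) • P.1 = 0 := P.2
    change (n : ℤ) • WeierstrassCurve.Affine.Point.map (W' := W) σ.toAlgHom P.1 = 0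
    rw [← map_zsmul, h, map_zero]⟩
  one_smul P := Subtype.ext <| by
    rcases P with ⟨_ | _, _⟩ <;> rfl
  mul_smul σ τ P := Subtype.ext <| by
    rcases P with ⟨_ | _, _⟩ <;> rfl
  smul_zero σ := Subtype.ext <| map_zero _
  smul_add σ P Q := Subtype.ext <|
    map_add (WeierstrassCurve.Affine.Point.map (W' := W) σ.toAlgHom) P.1 Q.1

/-- For a subgroup `I` of the absolute Galois group `G_F`, the kernel of the restriction map
`H¹(G_F, E[n]) → H¹(I, E[n])`. If `F` is a local field and `I` is its inertia subgroup, this is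
the group `H¹_ur(F, E[n])` of unramified classes. -/
noncomputable def unramifiedH1 (n : ℕ) (I : Subgroup Gal(AlgebraicClosure F/F)) :
    AddSubgroup (ContH1 Gal(AlgebraicClosure F/F) (torsionPoints W (AlgebraicClosure F) n)) :=
  (ContH1.res _ (torsionPoints W (AlgebraicClosure F) n) I).ker

end Torsion

/-! ### Inertia subgroups at the places of `ℚ` -/

/-- The inertia subgroup of `G_{ℚ_p}`: the automorphisms which preserve the valuation ring of
`\bar ℚ_p` and act trivially on its residue field. -/
noncomputable def padicInertia (p : ℕ) [Fact p.Prime] :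
    Subgroup Gal(AlgebraicClosure ℚ_[p]/ℚ_[p]) :=
  let A : ValuationSubring (PadicAlgCl p) :=
    (Valued.v : Valuation (PadicAlgCl p) ℝ≥0).valuationSubring
  (A.inertiaSubgroup ℚ_[p]).map (A.decompositionSubgroup ℚ_[p]).subtype

/-- The inertia subgroup of `G_ℝ`. By the usual convention the extension `ℂ/ℝ` is ramified, so
that the maximal unramified extension of `ℝ` is `ℝ` itself and inertia is all of `G_ℝ`. -/
noncomputable def realInertia : Subgroup Gal(AlgebraicClosure ℝ/ℝ) := ⊤

/-! ### Monogenized cubic étale algebras, binary cubic forms, and the associated curves -/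

/-- `(K, α)` is a monogenized cubic étale algebra over the fraction field `F` of `R`: `K` is an
étale `F`-algebra of degree 3 and `α` generates its ring of integers, the integral closure of `R`
in `K`, as an `R`-algebra. -/
structure IsMonogenizedCubic (R F K : Type*) [CommRing R] [Field F] [Algebra R F]
    [CommRing K] [Algebra F K] [Algebra R K] (α : K) : Prop where
  etale : Algebra.Etale F K
  finrank_eq : Module.finrank F K = 3
  adjoin_eq : Algebra.adjoin R {α} = integralClosure R K

/-- The monic binary cubic form `x³ + a x² y + b x y² + c y³`. -/
structure MonicBinaryCubic (F : Type*) where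
  a : F
  b : F
  c : F

namespace MonicBinaryCubic

/-- The polynomial `f(x, 1)`. -/
noncomputable def dehomogenize {F : Type*} [CommRing F] (f : MonicBinaryCubic F) : F[X] :=
  Polynomial.X ^ 3 + Polynomial.C f.a * Polynomial.X ^ 2 + Polynomial.C f.b * Polynomial.X
    + Polynomial.C f.c

/-- The invariant `I(f) = a² - 3b`. -/
def invI {F : Type*} [CommRing F] (f : MonicBinaryCubic F) : F := f.a ^ 2 - 3 * f.b

/-- The invariant `J(f) = -2a³ + 9ab - 27c`. -/
def invJ {F : Type*} [CommRing F] (f : MonicBinaryCubic F) : F :=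
  -2 * f.a ^ 3 + 9 * f.a * f.b - 27 * f.c

end MonicBinaryCubic

/-- The curve `E^{I,J} : y² = x³ - (I/3) x - J/27`. -/
def curveIJ {F : Type*} [Field F] (I J : F) : WeierstrassCurve F where
  a₁ := 0
  a₂ := 0
  a₃ := 0
  a₄ := -(I / 3)
  a₆ := -(J / 27)

/-- The curve `E_f = E^{3⁴ I(f), 3⁶ J(f)}` associated to `f`. -/
def MonicBinaryCubic.curve {F : Type*} [Field F] (f : MonicBinaryCubic F) : WeierstrassCurve F :=
  curveIJ (3 ^ 4 * f.invI) (3 ^ 6 * f.invJ)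

/-! At a finite place write G for the absolute Galois group, I for inertia and M for E[2], a finite
discrete G-module. Unramified classes form H¹(G/I, M^I), and G/I is free procyclic, generated by a
Frobenius φ. Hence this group is M^I/(φ-1)M^I. On the finite group M^I the cokernel of φ-1 has the
same order as its kernel, and that kernel is M^G = E(ℚ_p)[2].

The argument (`card_ker_res`) uses cocycles on G itself, never on G/I. Evaluation at φ identifies
the cocycles vanishing on I with M^I (`evalVanishing_injective`, `evalVanishing_surjective`) and the
coboundaries among them with (φ-1)M^I (`map_ker_classVanishing`). The arithmetic input is
`exists_isFreeProcyclicGenerator_inertia`: G/I is the absolute Galois group of a finite field.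
Galois descent (`card_fixed_torsionPoints`) identifies M^G.

At the real place inertia is all of G, so the restriction map is injective. -/

/-! ### Unramified classes when G/I is free procyclic. -/

section UnramifiedCohomology

variable {G M : Type*} [Group G] [TopologicalSpace G] [AddCommGroup M] [DistribMulAction G M]

/-- Restriction to the whole group is injective on `H¹`. -/
theorem ContH1.ker_res_top : (ContH1.res G M ⊤).ker = ⊥ := by
  rw [eq_bot_iff]
  intro x hx
  induction x using QuotientAddGroup.induction_on with
  | H c =>
    have h : ((contCocycles.res G M ⊤ c : contCocycles (⊤ : Subgroup G) M) :
        ContH1 (⊤ : Subgroup G) M) = 0 := hx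
    rw [QuotientAddGroup.eq_zero_iff] at h
    obtain ⟨m, hm⟩ := h
    exact (QuotientAddGroup.eq_zero_iff c).2 ⟨m, fun g => hm ⟨g, trivial⟩⟩

/-- The continuous cocycles on `G` which vanish on the subgroup `I`. -/
def contCocyclesVanishing (M : Type*) [AddCommGroup M] [DistribMulAction G M] (I : Subgroup G) :
    AddSubgroup (contCocycles G M) := (contCocycles.res G M I).ker

theorem mem_contCocyclesVanishing {I : Subgroup G} {c : contCocycles G M} :
    c ∈ contCocyclesVanishing M I ↔ ∀ g ∈ I, (c : G → M) g = 0 := by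
  refine ⟨fun h g hg => ?_, fun h => ?_⟩
  · exact congrFun (congrArg Subtype.val (show contCocycles.res G M I c = 0 from h)) ⟨g, hg⟩
  · exact Subtype.ext (funext fun g => h g g.2)

/-- A cocycle vanishing on a normal subgroup takes values in the invariants of that subgroup. -/
theorem smul_apply_of_mem_vanishing {I : Subgroup G} [I.Normal] {c : contCocycles G M}
    (hc : c ∈ contCocyclesVanishing M I) {i : G} (hi : i ∈ I) (g : G) :
    i • (c : G → M) g = (c : G → M) g := by
  rw [mem_contCocyclesVanishing] at hc
  have h1 : (c : G → M) (i * g) = i • (c : G → M) g := by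
    rw [c.2.2 i g, hc i hi, add_zero]
  have h2 : (c : G → M) (i * g) = (c : G → M) g := by
    have : i * g = g * (g⁻¹ * i * g) := by group
    have hmem : g⁻¹ * i * g ∈ I := by
      simpa using (inferInstance : I.Normal).conj_mem i hi g⁻¹
    rw [this, c.2.2 g, hc _ hmem, smul_zero, zero_add]
  rw [← h1, h2]

/-- The zero locus of a continuous cocycle, as a subgroup. -/
def zeroLocus (c : contCocycles G M) : Subgroup G where
  carrier := {g | (c : G → M) g = 0}
  one_mem' := groupCohomology.map_one_of_isCocycle₁ c.2.2
  mul_mem' {a b} ha hb := by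
    have h := c.2.2 a b
    rw [show (c : G → M) a = 0 from ha, show (c : G → M) b = 0 from hb] at h
    simpa using h
  inv_mem' {a} ha := by
    have h := c.2.2 a⁻¹ a
    rw [show (c : G → M) a = 0 from ha, inv_mul_cancel,
      groupCohomology.map_one_of_isCocycle₁ c.2.2] at h
    simpa using h.symm

theorem isClosed_zeroLocus (c : contCocycles G M) : IsClosed (zeroLocus c : Set G) :=
  c.2.1.isClosed_fiber 0

/-- `φ` is a topological generator of `G` modulo `I`, and `G / I` has continuous characters of
every finite order sending `φ` to a generator. This says that `G / I` is a free procyclic group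
on `φ`. -/
structure IsFreeProcyclicGenerator (I : Subgroup G) (φ : G) : Prop where
  eq_top : ∀ H : Subgroup G, IsClosed (H : Set G) → I ≤ H → φ ∈ H → H = ⊤
  exists_character : ∀ r : ℕ, 0 < r → ∃ χ : G →* Multiplicative (ZMod r),
    IsLocallyConstant χ ∧ I ≤ χ.ker ∧ χ φ = Multiplicative.ofAdd 1

/-- The endomorphism `m ↦ φ • m - m` of the invariants of a normal subgroup. -/
def smulSubHom (M : Type*) [AddCommGroup M] [DistribMulAction G M] (I : Subgroup G) [I.Normal]
    (φ : G) : FixedPoints.addSubgroup I M →+ FixedPoints.addSubgroup I M where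
  toFun m := ⟨φ • (m : M) - m, by
    rintro ⟨i, hi⟩
    have hmem : φ⁻¹ * i * φ ∈ I := by
      simpa using (inferInstance : I.Normal).conj_mem i hi φ⁻¹
    have h1 : i • (m : M) = m := m.2 ⟨i, hi⟩
    have h2 : (φ⁻¹ * i * φ) • (m : M) = m := m.2 ⟨_, hmem⟩
    have h3 : i • φ • (m : M) = φ • (m : M) := by
      conv_rhs => rw [← h2]
      simp only [smul_smul]
      congr 1
      group
    change i • (φ • (m : M) - m) = φ • (m : M) - m
    rw [smul_sub, h1, h3]⟩
  map_zero' := by ext; simp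
  map_add' a b := by
    ext
    simp only [AddSubgroup.coe_add, smul_add]
    abel

/-- Evaluation at `φ` of the cocycles vanishing on `I`. -/
def evalVanishing (M : Type*) [AddCommGroup M] [DistribMulAction G M] (I : Subgroup G) [I.Normal]
    (φ : G) : contCocyclesVanishing M I →+ FixedPoints.addSubgroup I M where
  toFun c := ⟨((c : contCocycles G M) : G → M) φ, fun i =>
    smul_apply_of_mem_vanishing c.2 i.2 φ⟩
  map_zero' := rfl
  map_add' _ _ := rfl

/-- The zero locus of a continuous cocycle is a closed subgroup; once it contains I and φ it is
everything. -/
theorem evalVanishing_injective {I : Subgroup G} [I.Normal] {φ : G}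
    (hφ : IsFreeProcyclicGenerator I φ) : Function.Injective (evalVanishing M I φ) := by
  rw [injective_iff_map_eq_zero]
  rintro ⟨c, hc⟩ h
  have htop := hφ.eq_top (zeroLocus c) (isClosed_zeroLocus c)
    (fun g hg => mem_contCocyclesVanishing.1 hc g hg) (congrArg Subtype.val h)
  refine Subtype.ext (Subtype.ext (funext fun g => ?_))
  have : g ∈ zeroLocus c := htop ▸ Subgroup.mem_top g
  exact this

/-- The permutation `x ↦ φ • x + m` of the invariants of a normal subgroup. -/
noncomputable def affinePerm {I : Subgroup G} [I.Normal] (φ : G) (m : FixedPoints.addSubgroup I M)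
    [Finite M] : Equiv.Perm (FixedPoints.addSubgroup I M) :=
  -- Writing φ • x as (φ • x - x) + x keeps the value inside the invariants.
  Equiv.ofBijective (fun x => smulSubHom M I φ x + x + m) (by
    rw [← Finite.injective_iff_bijective]
    intro x y h
    have h1 := congrArg Subtype.val h
    simpa [smulSubHom] using h1)

omit [TopologicalSpace G] in
theorem coe_affinePerm_apply {I : Subgroup G} [I.Normal] [Finite M] (φ : G)
    (m x : FixedPoints.addSubgroup I M) : (affinePerm φ m x : M) = φ • (x : M) + m := by
  simp [affinePerm, smulSubHom]

/-- Compose a character of order `orderOf t` with the map from `ZMod (orderOf t)` sending 1 to t. -/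
theorem IsFreeProcyclicGenerator.exists_hom {I : Subgroup G} {φ : G}
    (hφ : IsFreeProcyclicGenerator I φ) {Q : Type*} [Group Q] {t : Q} (ht : IsOfFinOrder t) :
    ∃ ψ : G →* Q, IsLocallyConstant ψ ∧ I ≤ ψ.ker ∧ ψ φ = t := by
  obtain ⟨χ, hχ, hχI, hχφ⟩ := hφ.exists_character (orderOf t) ht.orderOf_pos
  let f : ZMod (orderOf t) →+ Additive Q := ZMod.lift (orderOf t)
    ⟨zmultiplesHom (Additive Q) (Additive.ofMul t), by
      simp [← ofMul_pow, pow_orderOf_eq_one]⟩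
  have hf : f 1 = Additive.ofMul t := by
    have := ZMod.lift_coe (orderOf t)
      (⟨zmultiplesHom (Additive Q) (Additive.ofMul t), by
        simp [← ofMul_pow, pow_orderOf_eq_one]⟩ : {f : ℤ →+ Additive Q // f (orderOf t) = 0}) 1
    simpa [f] using this
  refine ⟨(AddMonoidHom.toMultiplicativeLeft f).comp χ,
    hχ.comp (AddMonoidHom.toMultiplicativeLeft f), fun i hi => ?_, ?_⟩
  · have : χ i = 1 := hχI hi
    simp [MonoidHom.mem_ker, this]
  · change (f (χ φ).toAdd).toMul = t
    rw [hχφ]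
    simp [hf]

theorem isLocallyConstant_smul [ContinuousMul G]
    (hM : ∀ m : M, IsOpen (MulAction.stabilizer G m : Set G)) (m : M) :
    IsLocallyConstant fun g : G => g • m := by
  rw [IsLocallyConstant.iff_exists_open]
  intro g
  refine ⟨(fun h => g⁻¹ * h) ⁻¹' (MulAction.stabilizer G m : Set G),
    (hM m).preimage (continuous_const_mul _), by simp, fun h hh => ?_⟩
  have : (g⁻¹ * h) • m = m := hh
  rw [mul_smul] at this
  conv_rhs => rw [← this]
  simp

/-- A cocycle c makes G act on M^I by the affine maps x ↦ g • x + c(g). If c(φ) = m, then φ must act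
by T : x ↦ φ • x + m. As a permutation of a finite set T has finite order, so some ψ trivial on I
sends φ to T, and c(g) = ψ(g)(0) is the cocycle sought. -/
theorem evalVanishing_surjective [ContinuousMul G] [Finite M]
    (hM : ∀ m : M, IsOpen (MulAction.stabilizer G m : Set G))
    {I : Subgroup G} [I.Normal] {φ : G}
    (hφ : IsFreeProcyclicGenerator I φ) : Function.Surjective (evalVanishing M I φ) := by
  intro m
  set T := affinePerm φ m with hT
  obtain ⟨ψ, hψ, hψI, hψφ⟩ := hφ.exists_hom (isOfFinOrder_of_finite T)
  -- The elements g for which ψ(g) is affine with linear part g. They form a closed subgroup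
  -- containing I and φ, hence all of G; this is the cocycle identity.
  let H : Subgroup G :=
    { carrier := {g | ∀ x, (ψ g x : M) = g • (x : M) + (ψ g 0 : M)}
      one_mem' := fun x => by simp
      mul_mem' := fun {a b} ha hb x => by
        have ha' : ∀ x, (ψ a x : M) = a • (x : M) + (ψ a 0 : M) := ha
        have hb' : ∀ x, (ψ b x : M) = b • (x : M) + (ψ b 0 : M) := hb
        rw [map_mul, Equiv.Perm.mul_apply, Equiv.Perm.mul_apply, ha', hb' x, ha' (ψ b 0), smul_add,
          mul_smul, add_assoc]
      inv_mem' := fun {a} ha x => by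
        have ha' : ∀ x, (ψ a x : M) = a • (x : M) + (ψ a 0 : M) := ha
        have h1 := ha' (ψ a⁻¹ x)
        have h2 := ha' (ψ a⁻¹ 0)
        have h3 (y) : ψ a (ψ a⁻¹ y) = y := by
          rw [← Equiv.Perm.mul_apply, ← map_mul]; simp
        rw [h3] at h1 h2
        rw [h1, smul_add, inv_smul_smul, add_assoc]
        have h4 : (ψ a 0 : M) = -(a • (ψ a⁻¹ 0 : M)) := by
          rw [eq_neg_iff_add_eq_zero, add_comm, ← h2, ZeroMemClass.coe_zero]
        rw [h4, smul_neg, inv_smul_smul, neg_add_cancel, add_zero] }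
  have hH : H = ⊤ := by
    refine hφ.eq_top H ?_ ?_ ?_
    · have : (H : Set G) = ⋂ x : FixedPoints.addSubgroup I M,
          {g | (ψ g x : M) = g • (x : M) + (ψ g 0 : M)} := by
        ext; simp [H]
      rw [this]
      refine isClosed_iInter fun x => ?_
      have hl : IsLocallyConstant fun g : G =>
          ((ψ g x : M), g • (x : M) + (ψ g 0 : M)) :=
        (hψ.comp fun σ => ((σ x : _) : M)).prodMk
          ((isLocallyConstant_smul hM x).add (hψ.comp fun σ => ((σ 0 : _) : M)))
      exact ⟨hl {y | ¬ y.1 = y.2}⟩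
    · intro i hi x
      have h1 : ψ i = 1 := hψI hi
      have h2 : i • (x : M) = x := x.2 ⟨i, hi⟩
      rw [h1]
      simp [h2]
    · intro x
      rw [hψφ, hT, coe_affinePerm_apply, coe_affinePerm_apply]
      simp
  have key (g : G) (x) : (ψ g x : M) = g • (x : M) + (ψ g 0 : M) :=
    (hH ▸ Subgroup.mem_top g : g ∈ H) x
  let c : contCocycles G M := ⟨fun g => (ψ g 0 : M), hψ.comp fun σ => ((σ 0 : _) : M), fun g h => by
    change (ψ (g * h) 0 : M) = g • (ψ h 0 : M) + ψ g 0
    rw [map_mul, Equiv.Perm.mul_apply, key]⟩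
  refine ⟨⟨c, mem_contCocyclesVanishing.2 fun g hg => ?_⟩, ?_⟩
  · have h1 : ψ g = 1 := hψI hg
    change (ψ g 0 : M) = 0
    simp [h1]
  · ext
    change (ψ φ 0 : M) = m
    rw [hψφ, hT, coe_affinePerm_apply]
    simp

/-- The class map from cocycles vanishing on `I` to classes which restrict to zero on `I`. -/
def classVanishing (M : Type*) [AddCommGroup M] [DistribMulAction G M] (I : Subgroup G) :
    contCocyclesVanishing M I →+ (ContH1.res G M I).ker :=
  ((QuotientAddGroup.mk' (contCoboundaries G M)).comp
    (contCocyclesVanishing M I).subtype).codRestrict _ fun c => by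
      have : contCocycles.res G M I c = 0 := c.2
      change ((contCocycles.res G M I c : contCocycles I M) : ContH1 I M) = 0
      rw [this]
      rfl

/-- If c agrees on I with the coboundary of m, subtract that coboundary on all of G. It is
continuous because stabilizers are open. -/
theorem classVanishing_surjective
    (hM : ∀ m : M, IsOpen (MulAction.stabilizer G m : Set G)) [ContinuousMul G]
    (I : Subgroup G) : Function.Surjective (classVanishing M I) := by
  rintro ⟨x, hx⟩
  induction x using QuotientAddGroup.induction_on with
  | H c =>
    have h : ((contCocycles.res G M I c : contCocycles I M) : ContH1 I M) = 0 := hx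
    rw [QuotientAddGroup.eq_zero_iff] at h
    obtain ⟨m, hm⟩ := h
    have hm' (g : G) (hg : g ∈ I) : g • m - m = (c : G → M) g := hm ⟨g, hg⟩
    let b : contCocycles G M := ⟨fun g => g • m - m,
      (isLocallyConstant_smul hM m).sub (IsLocallyConstant.const m), fun g h => by simp [mul_smul, smul_sub]⟩
    have hb : b ∈ contCoboundaries G M := ⟨m, fun g => rfl⟩
    refine ⟨⟨c - b, mem_contCocyclesVanishing.2 fun g hg => ?_⟩, ?_⟩
    · change (c : G → M) g - (g • m - m) = 0
      rw [hm' g hg, sub_self]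
    · refine Subtype.ext ?_
      change ((c - b : contCocycles G M) : ContH1 G M) = c
      rw [QuotientAddGroup.eq]
      simpa using hb

/-- The coboundary of m vanishes on I exactly when m is I-invariant, and its value at φ is φ • m -
m. -/
theorem map_ker_classVanishing
    (hM : ∀ m : M, IsOpen (MulAction.stabilizer G m : Set G)) [ContinuousMul G]
    (I : Subgroup G) [I.Normal] (φ : G) :
    (classVanishing M I).ker.map (evalVanishing M I φ) = (smulSubHom M I φ).range := by
  ext n
  constructor
  · rintro ⟨⟨c, hc⟩, hker, rfl⟩
    have h1 : (c : ContH1 G M) = 0 := congrArg Subtype.val hker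
    rw [QuotientAddGroup.eq_zero_iff] at h1
    obtain ⟨m, hm⟩ := h1
    refine ⟨⟨m, fun i => ?_⟩, Subtype.ext (hm φ)⟩
    have := hm i
    rw [mem_contCocyclesVanishing.1 hc i i.2, sub_eq_zero] at this
    exact this
  · rintro ⟨m, rfl⟩
    let b : contCocycles G M := ⟨fun g => g • (m : M) - m,
      (isLocallyConstant_smul hM _).sub (IsLocallyConstant.const _),
      fun g h => by simp [mul_smul, smul_sub]⟩
    have hb : b ∈ contCoboundaries G M := ⟨m, fun g => rfl⟩
    refine ⟨⟨b, mem_contCocyclesVanishing.2 fun g hg => ?_⟩, ?_, rfl⟩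
    · exact sub_eq_zero.2 (m.2 ⟨g, hg⟩)
    · exact Subtype.ext ((QuotientAddGroup.eq_zero_iff b).2 hb)

/-- The stabilizer of m is open, hence closed, and contains I and φ. -/
theorem mem_ker_smulSubHom_iff [ContinuousMul G]
    (hM : ∀ m : M, IsOpen (MulAction.stabilizer G m : Set G))
    {I : Subgroup G} [I.Normal] {φ : G} (hφ : IsFreeProcyclicGenerator I φ)
    (m : FixedPoints.addSubgroup I M) :
    m ∈ (smulSubHom M I φ).ker ↔ ∀ g : G, g • (m : M) = m := by
  constructor
  · intro h
    have hst : MulAction.stabilizer G (m : M) = ⊤ := by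
      refine hφ.eq_top _ (Subgroup.isClosed_of_isOpen _ (hM _)) (fun i hi => m.2 ⟨i, hi⟩) ?_
      exact sub_eq_zero.1 (congrArg Subtype.val h)
    exact fun g => (hst ▸ Subgroup.mem_top g : g ∈ MulAction.stabilizer G (m : M))
  · exact fun h => Subtype.ext (sub_eq_zero.2 (h φ))

/-- If `G / I` is free procyclic and `M` is a finite discrete `G`-module, then the kernel of
restriction `H¹(G, M) → H¹(I, M)` has as many elements as `M` has `G`-invariants. -/
theorem card_ker_res [ContinuousMul G] [Finite M]
    (hM : ∀ m : M, IsOpen (MulAction.stabilizer G m : Set G))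
    {I : Subgroup G} [I.Normal] {φ : G} (hφ : IsFreeProcyclicGenerator I φ) :
    Nat.card (ContH1.res G M I).ker = Nat.card {m : M // ∀ g : G, g • m = m} := by
  have e : contCocyclesVanishing M I ≃+ FixedPoints.addSubgroup I M :=
    AddEquiv.ofBijective (evalVanishing M I φ)
      ⟨evalVanishing_injective hφ, evalVanishing_surjective hM hφ⟩
  have h1 : Nat.card (ContH1.res G M I).ker * Nat.card (classVanishing M I).ker
      = Nat.card (FixedPoints.addSubgroup I M) := by
    rw [← Nat.card_congr e.toEquiv,
      AddSubgroup.card_eq_card_quotient_mul_card_addSubgroup (classVanishing M I).ker,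
      Nat.card_congr (QuotientAddGroup.quotientKerEquivOfSurjective _
        (classVanishing_surjective hM I)).toEquiv]
  have h2 : Nat.card (smulSubHom M I φ).range * Nat.card (smulSubHom M I φ).ker
      = Nat.card (FixedPoints.addSubgroup I M) := by
    rw [AddSubgroup.card_eq_card_quotient_mul_card_addSubgroup (smulSubHom M I φ).ker,
      Nat.card_congr (QuotientAddGroup.quotientKerEquivRange (smulSubHom M I φ)).toEquiv]
  have h3 : Nat.card (classVanishing M I).ker = Nat.card (smulSubHom M I φ).range := by
    rw [← map_ker_classVanishing hM I φ]
    exact Nat.card_congr (AddSubgroup.equivMapOfInjective _ _ (evalVanishing_injective hφ)).toEquiv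
  have h4 : Nat.card (smulSubHom M I φ).ker = Nat.card {m : M // ∀ g : G, g • m = m} :=
    Nat.card_congr
      { toFun := fun m => ⟨m, (mem_ker_smulSubHom_iff hM hφ m).1 m.2⟩
        invFun := fun m => ⟨⟨m, fun i => m.2 i⟩, (mem_ker_smulSubHom_iff hM hφ _).2 m.2⟩
        left_inv := fun _ => rfl
        right_inv := fun _ => rfl }
  -- Both factorizations of #M^I contain #(φ-1)M^I, which is nonzero by finiteness and cancels.
  rw [← h4]
  rw [h3, ← h2, mul_comm] at h1
  exact Nat.eq_of_mul_eq_mul_left Nat.card_pos h1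

end UnramifiedCohomology

/-! ### Absolute Galois groups of finite fields. -/

section FreeProcyclic

/-- Free procyclic generators lift along quotient maps of compact groups. -/
theorem IsFreeProcyclicGenerator.of_surjective {G G' : Type*} [Group G] [TopologicalSpace G]
    [IsTopologicalGroup G] [CompactSpace G] [Group G'] [TopologicalSpace G'] [T2Space G']
    {ρ : G →* G'} (hρ : Continuous ρ) {φ : G} (h : IsFreeProcyclicGenerator ⊥ (ρ φ)) :
    IsFreeProcyclicGenerator ρ.ker φ where
  eq_top H hH hI hφ := by
    -- By compactness the image of H is closed, and it contains the generator ρ φ.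
    have htop : H.map ρ = ⊤ := by
      refine h.eq_top _ ?_ bot_le ⟨φ, hφ, rfl⟩
      rw [Subgroup.coe_map]
      exact (hH.isCompact.image hρ).isClosed
    rw [eq_top_iff]
    intro g _
    obtain ⟨x, hx, hxg⟩ : ρ g ∈ H.map ρ := htop ▸ Subgroup.mem_top _
    have : x⁻¹ * g ∈ H := hI (by simp [MonoidHom.mem_ker, hxg])
    simpa using H.mul_mem hx this
  exists_character r hr := by
    obtain ⟨χ, hχ, -, hχφ⟩ := h.exists_character r hr
    refine ⟨χ.comp ρ, hχ.comp_continuous hρ, fun g hg => ?_, hχφ⟩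
    rw [MonoidHom.mem_ker] at hg ⊢
    simp [hg]

variable (κ k : Type*) [Field κ] [Fintype κ] [Field k] [Algebra κ k] [IsAlgClosure κ k]

/-- With q = #κ, an element fixed by Frobenius is a root of X^q - X, which already splits over κ. -/
theorem fixedField_eq_bot_of_frobenius_mem {H : Subgroup Gal(k/κ)}
    (hH : FiniteField.frobeniusAlgEquivOfAlgebraic κ k ∈ H) :
    IntermediateField.fixedField H = ⊥ := by
  rw [eq_bot_iff]
  intro x hx
  rw [IntermediateField.mem_fixedField_iff] at hx
  have hx1 : x ^ Fintype.card κ = x := hx _ hH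
  have hsplit : (Polynomial.X ^ Fintype.card κ - Polynomial.X : κ[X]).Splits := by
    simpa using (FiniteField.isSplittingField_sub κ κ).splits
  exact hsplit.mem_range_of_isRoot (i := algebraMap κ k)
    (FiniteField.X_pow_card_sub_X_ne_zero κ Fintype.one_lt_card) (by simp [hx1])

theorem exists_intermediateField_finrank_eq (r : ℕ) (hr : 0 < r) :
    ∃ L : IntermediateField κ k, Module.finrank κ L = r := by
  obtain ⟨p, hp⟩ := CharP.exists κ
  have : Fact p.Prime := ⟨CharP.char_is_prime κ p⟩
  have : NeZero r := ⟨hr.ne'⟩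
  have : IsAlgClosed k := IsAlgClosure.isAlgClosed κ
  let f : FiniteField.Extension κ p r →ₐ[κ] k := IsAlgClosed.lift
  refine ⟨f.fieldRange, ?_⟩
  refine Eq.trans ?_ (FiniteField.finrank_extension κ p r)
  exact (AlgEquiv.ofInjectiveField f).toLinearEquiv.finrank_eq.symm

/-- The absolute Galois group of a finite field is freely generated by Frobenius. -/
theorem isFreeProcyclicGenerator_frobenius :
    IsFreeProcyclicGenerator (⊥ : Subgroup Gal(k/κ))
      (FiniteField.frobeniusAlgEquivOfAlgebraic κ k) where
  eq_top H hH _ hφ := by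
    have : IsGalois κ k := ⟨⟩
    -- A closed subgroup is recovered from its fixed field, here κ.
    have h := InfiniteGalois.fixingSubgroup_fixedField (⟨H, hH⟩ : ClosedSubgroup Gal(k/κ))
    rw [← show _ = H from h]
    change (IntermediateField.fixedField H).fixingSubgroup = ⊤
    rw [fixedField_eq_bot_of_frobenius_mem κ k hφ, IntermediateField.fixingSubgroup_bot]
  exists_character r hr := by
    have : IsGalois κ k := ⟨⟩
    obtain ⟨L, hL⟩ := exists_intermediateField_finrank_eq κ k r hr
    have : FiniteDimensional κ L := Module.finite_of_finrank_pos (hL ▸ hr)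
    have : Finite L := Module.finite_of_finite κ
    have : NeZero r := ⟨hr.ne'⟩
    -- The character is restriction to the degree-r subextension L, whose Galois group is cyclic of
    -- order r on its own Frobenius.
    let F := FiniteField.frobeniusAlgEquivOfAlgebraic κ L
    have hgen (x : Gal(L/κ)) : x ∈ Subgroup.zpowers F := by
      obtain ⟨n, rfl⟩ := (FiniteField.bijective_frobeniusAlgEquivOfAlgebraic_pow κ L).2 x
      exact ⟨n.1, zpow_natCast _ _⟩
    have hgen' (x : Multiplicative (ZMod r)) :
        x ∈ Subgroup.zpowers (Multiplicative.ofAdd (1 : ZMod r)) := by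
      refine ⟨(x.toAdd.val : ℤ), ?_⟩
      change _ ^ (x.toAdd.val : ℤ) = x
      rw [zpow_natCast, ← ofAdd_nsmul]
      simp
    have hord : orderOf F = orderOf (Multiplicative.ofAdd (1 : ZMod r)) := by
      rw [FiniteField.orderOf_frobeniusAlgEquivOfAlgebraic, hL, orderOf_ofAdd_eq_addOrderOf,
        ZMod.addOrderOf_one]
    let e := mulEquivOfOrderOfEq hgen hgen' hord
    refine ⟨e.toMonoidHom.comp (AlgEquiv.restrictNormalHom L), ?_, bot_le, ?_⟩
    · exact ((IsLocallyConstant.iff_continuous _).2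
        (InfiniteGalois.restrictNormalHom_continuous L)).comp e
    · have hF : AlgEquiv.restrictNormalHom L (FiniteField.frobeniusAlgEquivOfAlgebraic κ k) = F := by
        ext x
        rw [AlgEquiv.restrictNormalHom_apply]
        rfl
      change e (AlgEquiv.restrictNormalHom L _) = _
      rw [hF]
      exact mulEquivOfOrderOfEq_apply_gen hgen hgen' hord

end FreeProcyclic

/-! ### The quotient of a profinite group by an inertia group. -/

section Inertia

open scoped Pointwise

variable {A B G : Type*} [CommRing A] [CommRing B] [Algebra A B] [Group G]
  [MulSemiringAction G B] [SMulCommClass G A B] [TopologicalSpace G]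

/-- A homomorphism to the Galois group of an algebraic extension of a finite field is continuous
as soon as stabilizers of elements are open. -/
theorem continuous_of_isOpen_setOf_apply_eq [IsTopologicalGroup G] {κ k : Type*} [Field κ]
    [Finite κ] [Field k] [Algebra κ k] (ρ : G →* Gal(k/κ))
    (h : ∀ x : k, IsOpen {g | ρ g x = x}) : Continuous ρ := by
  refine continuous_of_continuousAt_one ρ ?_
  rw [ContinuousAt, map_one, Filter.tendsto_def]
  intro s hs
  rw [krullTopology_mem_nhds_one_iff] at hs
  obtain ⟨E, hE, hEs⟩ := hs
  -- E is a finite set, so fixing it pointwise is a finite intersection of open conditions.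
  have : Finite E := Module.finite_of_finite κ
  have hopen : IsOpen (⋂ x : E, {g | ρ g x = x}) := isOpen_iInter_of_finite fun x => h x
  refine Filter.mem_of_superset (hopen.mem_nhds (by simp)) fun g hg => hEs ?_
  rw [SetLike.mem_coe, IntermediateField.mem_fixingSubgroup_iff]
  intro x hx
  exact Set.mem_iInter.1 hg ⟨x, hx⟩

/-- Let a profinite group `G` act on `B` with ring of invariants `A`, stabilizing a maximal ideal
`Q` with algebraically closed residue field, which lies over a maximal ideal of `A` with finite
residue field. Then the quotient of `G` by inertia is free procyclic. -/
theorem exists_isFreeProcyclicGenerator_inertia [IsTopologicalGroup G] [CompactSpace G]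
    [TotallyDisconnectedSpace G] [Algebra.IsInvariant A B G]
    (hB : ∀ b : B, IsOpen (MulAction.stabilizer G b : Set G))
    (P : Ideal A) [P.IsMaximal] [Finite (A ⧸ P)] (Q : Ideal B) [Q.IsMaximal] [Q.LiesOver P]
    (hQ : ∀ (g : G) (b : B), b ∈ Q → g • b ∈ Q)
    (hclosed : ∀ f : B[X], f.Monic → 0 < f.natDegree → ∃ b, f.eval b = 0) :
    ∃ φ : G, IsFreeProcyclicGenerator (Q.inertia G) φ := by
  let : Field (A ⧸ P) := Ideal.Quotient.field P
  let : Field (B ⧸ Q) := Ideal.Quotient.field Q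
  let := Fintype.ofFinite (A ⧸ P)
  -- With B discrete, open stabilizers mean a continuous action, as the results on profinite
  -- invariants require.
  let : TopologicalSpace B := ⊥
  have : DiscreteTopology B := ⟨rfl⟩
  have : ContinuousSMul G B := continuousSMul_iff_stabilizer_isOpen.2 hB
  have hint : Algebra.IsIntegral A B := Algebra.IsInvariant.isIntegral_of_profinite (G := G)
  have hint' : Algebra.IsIntegral (A ⧸ P) (B ⧸ Q) := inferInstance
  -- A monic polynomial over the residue field lifts to a monic one of the same degree, and a root
  -- of the lift reduces to a root.
  have halg : IsAlgClosed (B ⧸ Q) := by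
    refine IsAlgClosed.of_exists_root _ fun f hf hirr => ?_
    obtain ⟨g, hg, hdeg, hmonic⟩ := Polynomial.lifts_and_natDegree_eq_and_monic
      (Polynomial.map_surjective _ (Ideal.Quotient.mk_surjective (I := Q)) f) hf
    obtain ⟨b, hb⟩ := hclosed g hmonic (hdeg ▸ hirr.natDegree_pos)
    exact ⟨Ideal.Quotient.mk Q b, by
      rw [← hg, Polynomial.eval_map, Polynomial.eval₂_hom, hb, map_zero]⟩
  have : IsAlgClosure (A ⧸ P) (B ⧸ Q) := ⟨halg, Algebra.IsIntegral.isAlgebraic⟩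
  have hstab (g : G) : g ∈ MulAction.stabilizer G Q := by
    rw [MulAction.mem_stabilizer_iff]
    ext b
    rw [Ideal.mem_pointwise_smul_iff_inv_smul_mem]
    exact ⟨fun h => by simpa using hQ g _ h, fun h => hQ g⁻¹ b h⟩
  -- Since Q is G-stable, its decomposition group is G, so reduction is defined on all of G.
  let ρ : G →* Gal((B ⧸ Q)/(A ⧸ P)) := (Ideal.Quotient.stabilizerHom Q P G).comp
    ((MonoidHom.id G).codRestrict (MulAction.stabilizer G Q) hstab)
  have hρ (g : G) (b : B) : ρ g (Ideal.Quotient.mk Q b) = Ideal.Quotient.mk Q (g • b) := rfl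
  have hker : ρ.ker = Q.inertia G := by
    ext g
    rw [MonoidHom.mem_ker]
    constructor
    · intro h b
      change g • b - b ∈ Q
      rw [← Ideal.Quotient.eq, ← hρ, h]
      rfl
    · intro h
      refine AlgEquiv.ext fun x => ?_
      obtain ⟨b, rfl⟩ := Ideal.Quotient.mk_surjective x
      rw [hρ, AlgEquiv.one_apply, Ideal.Quotient.eq]
      exact h b
  have hcont : Continuous ρ := by
    refine continuous_of_isOpen_setOf_apply_eq ρ fun x => ?_
    obtain ⟨b, rfl⟩ := Ideal.Quotient.mk_surjective x
    have hle : MulAction.stabilizer G b ≤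
        (MulAction.stabilizer Gal((B ⧸ Q)/(A ⧸ P)) (Ideal.Quotient.mk Q b)).comap ρ := by
      intro g hg
      have hg' : g • b = b := hg
      change ρ g (Ideal.Quotient.mk Q b) = _
      rw [hρ, hg']
    exact Subgroup.isOpen_mono hle (hB b)
  -- φ lifts the residual Frobenius: the decomposition group surjects onto the residual Galois
  -- group.
  obtain ⟨⟨φ, hφ⟩, hφF⟩ := Ideal.Quotient.stabilizerHom_surjective_of_profinite (G := G) P Q
    (FiniteField.frobeniusAlgEquivOfAlgebraic (A ⧸ P) (B ⧸ Q))
  refine ⟨φ, hker ▸ IsFreeProcyclicGenerator.of_surjective hcont ?_⟩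
  have : ρ φ = FiniteField.frobeniusAlgEquivOfAlgebraic (A ⧸ P) (B ⧸ Q) := hφF
  rw [this]
  exact isFreeProcyclicGenerator_frobenius _ _

end Inertia

/-! ### Two-torsion as a finite discrete Galois module, and descent. -/

section TwoTorsion

variable {F : Type*} [Field F]

/-- Two-torsion points of `y² = x³ - (I/3) x - J/27` have vanishing `y`-coordinate. -/
theorem y_eq_zero_of_mem_torsionPoints_two (I J : F) (L : Type*) [Field L] [Algebra F L]
    (h2 : (2 : L) ≠ 0) {x y : L} {h : ((curveIJ I J).baseChange L).toAffine.Nonsingular x y}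
    (hP : (.some x y h : ((curveIJ I J).baseChange L).toAffine.Point) ∈
      torsionPoints (curveIJ I J) L 2) : y = 0 := by
  classical
  have h1 : (2 : ℤ) • (.some x y h : ((curveIJ I J).baseChange L).toAffine.Point) = 0 :=
    hP
  rw [two_zsmul, add_eq_zero_iff_eq_neg, WeierstrassCurve.Affine.Point.neg_some] at h1
  have h3 := (WeierstrassCurve.Affine.Point.some.inj h1).2
  simp only [WeierstrassCurve.Affine.negY, WeierstrassCurve.baseChange, curveIJ,
    WeierstrassCurve.map_a₁, WeierstrassCurve.map_a₃, map_zero, zero_mul, sub_zero] at h3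
  have h4 : 2 * y = 0 := by linear_combination h3
  exact (mul_eq_zero.1 h4).resolve_left h2

/-- An affine 2-torsion point has y = 0, so it is determined by x, a root of a monic cubic. -/
theorem finite_torsionPoints_two (I J : F) (L : Type*) [Field L] [Algebra F L]
    (h2 : (2 : L) ≠ 0) : Finite (torsionPoints (curveIJ I J) L 2) := by
  let f : L[X] := Polynomial.X ^ 3 + (Polynomial.C (algebraMap F L (-(I / 3))) * Polynomial.X
    + Polynomial.C (algebraMap F L (-(J / 27))))
  have hf : f ≠ 0 := by
    have : f.Monic := by
      refine Polynomial.monic_X_pow_add ?_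
      refine (Polynomial.degree_linear_le).trans_lt (by norm_num)
    exact this.ne_zero
  have hroot {x y : L} {h : ((curveIJ I J).baseChange L).toAffine.Nonsingular x y}
      (hP : (.some x y h : ((curveIJ I J).baseChange L).toAffine.Point) ∈
        torsionPoints (curveIJ I J) L 2) : f.IsRoot x := by
    have hy := y_eq_zero_of_mem_torsionPoints_two I J L h2 hP
    have h1 := (WeierstrassCurve.Affine.equation_iff _ _).1 h.1
    rw [hy] at h1
    simp only [WeierstrassCurve.baseChange, curveIJ, WeierstrassCurve.map_a₁,
      WeierstrassCurve.map_a₂, WeierstrassCurve.map_a₃, WeierstrassCurve.map_a₄,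
      WeierstrassCurve.map_a₆, map_zero] at h1
    simp only [f, Polynomial.IsRoot, Polynomial.eval_add, Polynomial.eval_mul,
      Polynomial.eval_pow, Polynomial.eval_X, Polynomial.eval_C]
    linear_combination -h1
  have : Finite {x // f.IsRoot x} := (Polynomial.finite_setOfPred_isRoot hf).to_subtype
  let e : torsionPoints (curveIJ I J) L 2 → Option {x // f.IsRoot x} := fun P =>
    match P with
    | ⟨.zero, _⟩ => none
    | ⟨.some x _ _, hP⟩ => some ⟨x, hroot hP⟩
  refine Finite.of_injective e ?_
  rintro ⟨_ | ⟨x, y, h⟩, hP⟩ ⟨_ | ⟨x', y', h'⟩, hP'⟩ he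
  · rfl
  · simp [e] at he
  · simp [e] at he
  · have hx : x = x' := by simpa [e] using he
    have hy := y_eq_zero_of_mem_torsionPoints_two I J L h2 hP
    have hy' := y_eq_zero_of_mem_torsionPoints_two I J L h2 hP'
    subst hx hy hy'
    rfl

variable (W : WeierstrassCurve F) (L : Type*) [Field L] [Algebra F L]

/-- The `n`-torsion of a Weierstrass curve over an algebraic extension is a discrete Galois
module. -/
theorem isOpen_stabilizer_torsionPoints [Algebra.IsAlgebraic F L] (n : ℕ)
    (P : torsionPoints W L n) :
    IsOpen (MulAction.stabilizer Gal(L/F) P : Set Gal(L/F)) := by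
  obtain ⟨_ | ⟨x, y, h⟩, hP⟩ := P
  · convert isOpen_univ
    ext g
    simp only [SetLike.mem_coe, MulAction.mem_stabilizer_iff, Set.mem_univ, iff_true]
    rfl
  · have hle : MulAction.stabilizer Gal(L/F) x ⊓ MulAction.stabilizer Gal(L/F) y ≤
        MulAction.stabilizer Gal(L/F)
          (⟨.some x y h, hP⟩ : torsionPoints W L n) := by
      rintro g ⟨hx, hy⟩
      have hx' : g x = x := hx
      have hy' : g y = y := hy
      refine Subtype.ext ?_
      change WeierstrassCurve.Affine.Point.some (g x) (g y) _ = .some x y h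
      simp only [hx', hy']
    exact Subgroup.isOpen_mono hle
      ((stabilizer_isOpen_of_isIntegral x).inter (stabilizer_isOpen_of_isIntegral y))

/-- Galois descent for torsion points. -/
theorem card_fixed_torsionPoints [IsGalois F L] (n : ℕ) :
    Nat.card {P : torsionPoints W L n // ∀ g : Gal(L/F), g • P = P} =
      Nat.card (torsionPoints W F n) := by
  classical
  let f := WeierstrassCurve.Affine.Point.map (W' := W) (Algebra.ofId F L)
  have hf : Function.Injective f := WeierstrassCurve.Affine.Point.map_injective _
  have hmem (P : (W.baseChange F).toAffine.Point) :
      f P ∈ torsionPoints W L n ↔ P ∈ torsionPoints W F n := by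
    have h1 : f P ∈ torsionPoints W L n ↔ (n : ℤ) • f P = 0 := Iff.rfl
    have h2 : P ∈ torsionPoints W F n ↔ (n : ℤ) • P = 0 := Iff.rfl
    rw [h1, h2, ← map_zsmul, map_eq_zero_iff f hf]
  have hfix (P : torsionPoints W F n) (g : Gal(L/F)) :
      g • (⟨f P.1, (hmem _).2 P.2⟩ : torsionPoints W L n) = ⟨f P.1, (hmem _).2 P.2⟩ := by
    obtain ⟨_ | ⟨x, y, h⟩, hP⟩ := P
    · rfl
    · refine Subtype.ext ?_
      change WeierstrassCurve.Affine.Point.some (g (algebraMap F L x)) (g (algebraMap F L y)) _ =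
        .some (algebraMap F L x) (algebraMap F L y) _
      simp only [AlgEquiv.commutes]
  symm
  refine Nat.card_congr (Equiv.ofBijective
    (fun P => ⟨⟨f P.1, (hmem _).2 P.2⟩, hfix P⟩) ⟨fun P Q h => ?_, ?_⟩)
  · exact Subtype.ext (hf (congrArg (fun R => R.1.1) h))
  · rintro ⟨⟨_ | ⟨x, y, h⟩, hP⟩, hfixed⟩
    · exact ⟨0, rfl⟩
    · have hxy (g : Gal(L/F)) : g x = x ∧ g y = y :=
        WeierstrassCurve.Affine.Point.some.inj (congrArg Subtype.val (hfixed g))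
      obtain ⟨x, rfl⟩ := (InfiniteGalois.mem_range_algebraMap_iff_fixed x).2 fun g => (hxy g).1
      obtain ⟨y, rfl⟩ := (InfiniteGalois.mem_range_algebraMap_iff_fixed y).2 fun g => (hxy g).2
      have h0 : (W.baseChange F).toAffine.Nonsingular x y :=
        (W.toAffine.baseChange_nonsingular (f := Algebra.ofId F L) (Algebra.ofId F L).injective x y).1 h
      exact ⟨⟨.some x y h0, (hmem _).1 hP⟩, rfl⟩

end TwoTorsion

/-! ### Inertia over ℚ_p and the finite places. -/

section Padic

open scoped Pointwise

variable (p : ℕ) [Fact p.Prime]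

/-- The valuation ring of `\bar ℚ_p`. -/
noncomputable abbrev padicAlgClInt : ValuationSubring (PadicAlgCl p) :=
  (Valued.v : Valuation (PadicAlgCl p) ℝ≥0).valuationSubring

theorem mem_padicAlgClInt_iff {x : PadicAlgCl p} : x ∈ padicAlgClInt p ↔ ‖x‖ ≤ 1 := by
  rw [Valuation.mem_valuationSubring_iff, PadicAlgCl.valuation_def]
  exact NNReal.coe_le_one

/-- The norm is the spectral norm, invariant under ℚ_p-automorphisms. Hence the whole Galois group
preserves the valuation ring and its maximal ideal. -/
theorem norm_galois_apply (g : Gal(PadicAlgCl p/ℚ_[p])) (x : PadicAlgCl p) : ‖g x‖ = ‖x‖ :=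
  (spectralNorm_eq_of_equiv g x).symm

noncomputable instance : MulSemiringAction Gal(PadicAlgCl p/ℚ_[p]) (padicAlgClInt p) where
  smul g x := ⟨g x, by
    rw [mem_padicAlgClInt_iff, norm_galois_apply, ← mem_padicAlgClInt_iff]; exact x.2⟩
  one_smul x := rfl
  mul_smul g h x := rfl
  smul_zero g := Subtype.ext (map_zero g)
  smul_add g x y := Subtype.ext (map_add g _ _)
  smul_one g := Subtype.ext (map_one g)
  smul_mul g x y := Subtype.ext (map_mul g _ _)

theorem coe_galois_smul (g : Gal(PadicAlgCl p/ℚ_[p])) (x : padicAlgClInt p) :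
    ((g • x : padicAlgClInt p) : PadicAlgCl p) = g x := rfl

noncomputable instance : Algebra ℤ_[p] (padicAlgClInt p) :=
  RingHom.toAlgebra (((algebraMap ℚ_[p] (PadicAlgCl p)).comp PadicInt.Coe.ringHom).codRestrict
    (padicAlgClInt p).toSubring fun x => by
      change _ ∈ padicAlgClInt p
      rw [mem_padicAlgClInt_iff]
      exact (PadicAlgCl.norm_extends p x).trans_le x.2)

theorem coe_algebraMap_padicAlgClInt (x : ℤ_[p]) :
    ((algebraMap ℤ_[p] (padicAlgClInt p) x : padicAlgClInt p) : PadicAlgCl p) =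
      algebraMap ℚ_[p] (PadicAlgCl p) x := rfl

instance : SMulCommClass Gal(PadicAlgCl p/ℚ_[p]) ℤ_[p] (padicAlgClInt p) where
  smul_comm g a x := by
    refine Subtype.ext ?_
    rw [Algebra.smul_def, Algebra.smul_def, coe_galois_smul]
    change g (_ * _) = _ * g _
    rw [map_mul, coe_algebraMap_padicAlgClInt, AlgEquiv.commutes]

/-- A Galois-fixed element lies in ℚ_p, and norm at most 1 puts it in ℤ_p. -/
instance : Algebra.IsInvariant ℤ_[p] (padicAlgClInt p) Gal(PadicAlgCl p/ℚ_[p]) where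
  isInvariant x hx := by
    obtain ⟨a, ha⟩ := (InfiniteGalois.mem_range_algebraMap_iff_fixed (x : PadicAlgCl p)).2
      fun g : Gal(PadicAlgCl p/ℚ_[p]) => congrArg Subtype.val (hx g)
    have h1 := (mem_padicAlgClInt_iff p).1 x.2
    rw [← ha, PadicAlgCl.norm_extends] at h1
    exact ⟨⟨a, h1⟩, Subtype.ext ha⟩

theorem mem_maximalIdeal_padicAlgClInt_iff {x : padicAlgClInt p} :
    x ∈ IsLocalRing.maximalIdeal (padicAlgClInt p) ↔ ‖(x : PadicAlgCl p)‖ < 1 := by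
  have hx := (mem_padicAlgClInt_iff p).1 x.2
  rw [IsLocalRing.mem_maximalIdeal, mem_nonunits_iff, lt_iff_le_and_ne]
  simp only [hx, true_and]
  refine not_congr ⟨fun h => ?_, fun h => ?_⟩
  · obtain ⟨y, hy⟩ := h.exists_right_inv
    have h1 : ‖(x : PadicAlgCl p)‖ * ‖(y : PadicAlgCl p)‖ = 1 := by
      rw [← norm_mul, show (x : PadicAlgCl p) * y = 1 from congrArg Subtype.val hy, norm_one]
    have h2 := (mem_padicAlgClInt_iff p).1 y.2
    nlinarith [norm_nonneg (x : PadicAlgCl p)]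
  · have h0 : (x : PadicAlgCl p) ≠ 0 := by
      rw [← norm_ne_zero_iff, h]
      exact one_ne_zero
    refine IsUnit.of_mul_eq_one ⟨(x : PadicAlgCl p)⁻¹, ?_⟩ (Subtype.ext (mul_inv_cancel₀ h0))
    rw [mem_padicAlgClInt_iff, norm_inv, h, inv_one]

instance : (IsLocalRing.maximalIdeal (padicAlgClInt p)).LiesOver
    (IsLocalRing.maximalIdeal ℤ_[p]) := ⟨by
  ext x
  rw [Ideal.mem_comap, mem_maximalIdeal_padicAlgClInt_iff, coe_algebraMap_padicAlgClInt,
    PadicAlgCl.norm_extends, IsLocalRing.mem_maximalIdeal, PadicInt.mem_nonunits,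
    PadicInt.norm_def]⟩

/-- A root in the algebraically closed field is integral over the valuation ring, which is
integrally closed. -/
theorem padicAlgClInt_exists_root (f : (padicAlgClInt p)[X]) (hf : f.Monic)
    (hdeg : 0 < f.natDegree) : ∃ b, f.eval b = 0 := by
  obtain ⟨x, hx⟩ := IsAlgClosed.exists_aeval_eq_zero (PadicAlgCl p) f
    (by rw [Polynomial.degree_eq_natDegree hf.ne_zero]; exact_mod_cast hdeg.ne')
  obtain ⟨b, rfl⟩ := IsIntegrallyClosed.isIntegral_iff.1
    (⟨f, hf, hx⟩ : IsIntegral (padicAlgClInt p) x)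
  refine ⟨b, ?_⟩
  rw [Polynomial.aeval_algebraMap_apply] at hx
  simpa using hx

/-- Invariance of the norm makes the decomposition group everything, so inertia can be computed from
the action on the valuation ring modulo its maximal ideal. -/
theorem padicInertia_eq :
    padicInertia p = (IsLocalRing.maximalIdeal (padicAlgClInt p)).inertia
      Gal(PadicAlgCl p/ℚ_[p]) := by
  ext g
  constructor
  · rintro ⟨d, hd, rfl⟩ x
    have h1 := congrArg (fun e => e (IsLocalRing.residue (padicAlgClInt p) x))
      (MonoidHom.mem_ker.1 hd)
    exact Ideal.Quotient.eq.1 h1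
  · intro h
    have hg : g ∈ (padicAlgClInt p).decompositionSubgroup ℚ_[p] := by
      rw [MulAction.mem_stabilizer_iff]
      ext x
      rw [ValuationSubring.mem_pointwise_smul_iff_inv_smul_mem, mem_padicAlgClInt_iff,
        mem_padicAlgClInt_iff]
      exact Iff.of_eq (congrArg (· ≤ 1) (norm_galois_apply p g⁻¹ x))
    refine ⟨⟨g, hg⟩, MonoidHom.mem_ker.2 (RingEquiv.ext fun y => ?_), rfl⟩
    obtain ⟨x, rfl⟩ := IsLocalRing.residue_surjective y
    exact Ideal.Quotient.eq.2 (h x)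

theorem galois_smul_mem_maximalIdeal (g : Gal(PadicAlgCl p/ℚ_[p])) {b : padicAlgClInt p}
    (hb : b ∈ IsLocalRing.maximalIdeal (padicAlgClInt p)) :
    g • b ∈ IsLocalRing.maximalIdeal (padicAlgClInt p) := by
  rw [mem_maximalIdeal_padicAlgClInt_iff] at hb ⊢
  rwa [coe_galois_smul, norm_galois_apply]

instance : (padicInertia p).Normal := by
  rw [padicInertia_eq]
  refine ⟨fun g hg h x => ?_⟩
  have h1 := galois_smul_mem_maximalIdeal p h (hg (h⁻¹ • x))
  rwa [smul_sub, smul_inv_smul, smul_smul, smul_smul] at h1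

theorem exists_isFreeProcyclicGenerator_padicInertia :
    ∃ φ, IsFreeProcyclicGenerator (padicInertia p) φ := by
  have : Finite (ℤ_[p] ⧸ IsLocalRing.maximalIdeal ℤ_[p]) :=
    Finite.of_equiv _ (PadicInt.residueField (p := p)).symm.toEquiv
  rw [padicInertia_eq]
  refine exists_isFreeProcyclicGenerator_inertia (fun b => ?_) (IsLocalRing.maximalIdeal ℤ_[p]) _
    (fun g b hb => galois_smul_mem_maximalIdeal p g hb) (padicAlgClInt_exists_root p)
  convert stabilizer_isOpen_of_isIntegral (K := ℚ_[p]) (b : PadicAlgCl p) using 2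
  ext g
  exact Subtype.ext_iff

theorem card_unramifiedH1_padic (f : MonicBinaryCubic ℚ_[p]) :
    Nat.card (unramifiedH1 f.curve 2 (padicInertia p)) =
      Nat.card (torsionPoints f.curve ℚ_[p] 2) := by
  obtain ⟨φ, hφ⟩ := exists_isFreeProcyclicGenerator_padicInertia p
  have : Finite (torsionPoints f.curve (PadicAlgCl p) 2) :=
    finite_torsionPoints_two _ _ _ two_ne_zero
  rw [← card_fixed_torsionPoints f.curve (PadicAlgCl p) 2]
  exact card_ker_res (isOpen_stabilizer_torsionPoints f.curve (PadicAlgCl p) 2) hφ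

end Padic

theorem mainTheorem6 :
    (∀ (p : ℕ) [Fact p.Prime] (K : Type*) [CommRing K] [Algebra ℚ_[p] K] [Algebra ℤ_[p] K]
        [IsScalarTower ℤ_[p] ℚ_[p] K] (α : K) (f : MonicBinaryCubic ℚ_[p]),
        IsMonogenizedCubic ℤ_[p] ℚ_[p] K α →
        f.dehomogenize = minpoly ℚ_[p] α →
        Nat.card (unramifiedH1 f.curve 2 (padicInertia p)) =
          Nat.card (torsionPoints f.curve ℚ_[p] 2)) ∧
    (∀ (K : Type*) [CommRing K] [Algebra ℝ K] (α : K) (f : MonicBinaryCubic ℝ),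
        IsMonogenizedCubic ℝ ℝ K α →
        f.dehomogenize = minpoly ℝ α →
        Nat.card (unramifiedH1 f.curve 2 realInertia) = 1) := by
  refine ⟨fun p _ K _ _ _ _ α f _ _ => card_unramifiedH1_padic p f, fun K _ _ α f _ _ => ?_⟩
  -- `realInertia` unfolds to the whole group.
  have h : unramifiedH1 f.curve 2 realInertia = ⊥ := ContH1.ker_res_top
  rw [h]
  exact Nat.card_unique
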